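/- All systems are finite-dimensional, $\|X\|=\mathrm{Tr}\sqrt{X^\dagger X}$ is the trace norm, a quantum channel (trace-preserving quantum operation) is a completely positive trace-preserving linear map, and $\|\Phi-\Psi\|_\diamond=\sup_{\rho_{ar}}\|(\Phi\otimes\mathcal I_r)(\rho_{ar})-(\Psi\otimes\mathcal I_r)(\rho_{ar})\|$, the supremum being over all reference systems $r$ and all states $\rho_{ar}$. Let $d,M\ge 1$ and $|\Phi\rangle=d^{-1/2}\sum_k|k\rangle|k\rangle$. *PBT channel.* Let $C$, $\mathbf A=A_1\cdots A_M$, $\mathbf B=B_1\cdots B_M$ be $d$-dimensional qudits, and put $\sigma^i=|\Phi\rangle\langle\Phi|_{A_iC}\otimes \mathbb I_{\bar A_i}/d^{M-1}$, $\varrho=\sum_i\sigma^i$, and $$\Pi^i=\varrho^{-1/2}\sigma^i\varrho^{-1/2}+M^{-1}\bigl(\mathbb I-\varrho^{-1/2}\varrho\,\varrho^{-1/2}\bigr)$$ (square-root measurement; $\varrho^{-1/2}$ is taken on the support of $\varrho$). The $M$-port PBT channel is $$\Gamma_M(\rho_C)=\sum_{i=1}^M\mathrm{Tr}_{\mathbf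 A\bar B_iC}\bigl[\Pi^i_{C\mathbf A}\,(\rho_C\otimes|\Phi\rangle\langle\Phi|_{\mathbf{AB}}^{\otimes M})\bigr],$$ where $\mathrm{Tr}_{\bar B_i}$ is the trace over all ports but $B_i$. The $M$-port simulation error is $\delta_M=\|\mathcal I-\Gamma_M\|_\diamond$. *Adaptive protocols.* An $n$-use adaptive protocol (with any task) over a channel $\mathcal E$ with $d$-dimensional input (and output of any finite dimension) has two registers $\mathbf a$, $\mathbf b$, of arbitrary finite dimensions that may change from step to step. It starts in some state of $\mathbf a\mathbf b$ and applies a trace-preserving quantum operation $\Lambda_0$ to $\mathbf{ab}$; then, for $i=1,\dots,n$, a $d$-dimensional system of $\mathbf a$ is sent through $\mathcal E$, the output is merged with $\mathbf b$, and a trace-preserving quantum operation $\Lambda_i$ is applied to $\mathbf{ab}$. The resulting state is the output $\rho_n=\rho_n(\mathcal E)$. **Lemma (PBT stretching).** For every $n\ge 0$ and every $n$-use adaptive protocol (that is, every initial state and every sequence $\Lambda_0,\dots,\Lambda_n$) there is a trace-preserving quantum operation $\bar\Lambda$, depending on the protocol and on $M$ but not on the channel, such that for every channel $\mathcal E$ with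 $d$-dimensional input (and the given output dimension) $$\|\rho_n(\mathcal E)-\bar\Lambda(\rho_{\mathcal E}^{\otimes nM})\|\le n\,\delta_M ,$$ where $\rho_{\mathcal E}=(\mathcal I\otimes\mathcal E)(|\Phi\rangle\langle\Phi|)$ is the Choi matrix of $\mathcal E$. Moreover, if all the $\Lambda_i$ are LOCCs between the owner of $\mathbf a$ (Alice) and the owner of $\mathbf b$ (Bob) and the initial state is a product state of $\mathbf a$ and $\mathbf b$, then $\bar\Lambda$ may be taken to be a trace-preserving LOCC, where Alice holds the first (input) system and Bob the second (output) system of each copy of $\rho_{\mathcal E}$. Here a trace-preserving LOCC is a map implemented in finitely many rounds: in each round Alice or Bob applies a local quantum instrument with finitely many outcomes and broadcasts the outcome, on which all later steps may depend; finally both apply local channels, and one averages over the outcomes. -/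

import Mathlib

open scoped Kronecker Matrix ComplexOrder

noncomputable section

namespace PBT

/-! ### Operators, maps between operator spaces, states and channels

A finite-dimensional quantum system is given by a finite type `X` labelling an orthonormal basis
of its Hilbert space; the composite of `X` and `Y` is labelled by `X × Y`. -/

/-- Operators on the system with basis `X`. -/
abbrev Op (X : Type) : Type := Matrix X X ℂ

/-- Linear maps from the operators of one system to those of another. -/
abbrev SuperOp (X Y : Type) : Type := Op X →ₗ[ℂ] Op Y

/-- `Φ ⊗ id` on the composite of the system of `Φ` with a further system `R`. -/
def tensorId {X Y : Type} (Φ : SuperOp X Y) (R : Type) : SuperOp (X × R) (Y × R) where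
  toFun ρ := Matrix.of fun p q => Φ (Matrix.of fun x x' => ρ (x, p.2) (x', q.2)) p.1 q.1
  map_add' ρ σ := by
    ext p q
    exact congrFun (congrFun (map_add Φ (Matrix.of fun x x' => ρ (x, p.2) (x', q.2))
      (Matrix.of fun x x' => σ (x, p.2) (x', q.2))) p.1) q.1
  map_smul' c ρ := by
    ext p q
    exact congrFun (congrFun (map_smul Φ c (Matrix.of fun x x' => ρ (x, p.2) (x', q.2))) p.1) q.1

/-- `id ⊗ Ψ` on the composite of a further system `R` with the system of `Ψ`. -/
def idTensor (R : Type) {X Y : Type} (Ψ : SuperOp X Y) : SuperOp (R × X) (R × Y) where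
  toFun ρ := Matrix.of fun p q => Ψ (Matrix.of fun x x' => ρ (p.1, x) (q.1, x')) p.2 q.2
  map_add' ρ σ := by
    ext p q
    exact congrFun (congrFun (map_add Ψ (Matrix.of fun x x' => ρ (p.1, x) (q.1, x'))
      (Matrix.of fun x x' => σ (p.1, x) (q.1, x'))) p.2) q.2
  map_smul' c ρ := by
    ext p q
    exact congrFun (congrFun (map_smul Ψ c (Matrix.of fun x x' => ρ (p.1, x) (q.1, x'))) p.2) q.2

/-- The tensor product `Φ ⊗ Ψ = (Φ ⊗ id) ∘ (id ⊗ Ψ)`. -/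
def tensorMap {X Y X' Y' : Type} (Φ : SuperOp X X') (Ψ : SuperOp Y Y') :
    SuperOp (X × Y) (X' × Y') :=
  tensorId Φ Y' ∘ₗ idTensor X Ψ

/-- Complete positivity: `Φ ⊗ id` is positive for every finite-dimensional ancilla. -/
def IsCP {X Y : Type} (Φ : SuperOp X Y) : Prop :=
  ∀ (k : ℕ) (ρ : Op (X × Fin k)), ρ.PosSemidef → (tensorId Φ (Fin k) ρ).PosSemidef

/-- Quantum channels (trace-preserving quantum operations): completely positive and
trace-preserving linear maps. -/
structure IsChannel {X Y : Type} [Fintype X] [Fintype Y] (Φ : SuperOp X Y) : Prop where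
  cp : IsCP Φ
  tp : ∀ ρ : Op X, (Φ ρ).trace = ρ.trace

/-- Density operators. -/
structure IsDensity {X : Type} [Fintype X] (ρ : Op X) : Prop where
  pos : ρ.PosSemidef
  trace_one : ρ.trace = 1

/-- The trace norm `‖A‖ = Tr √(A† A)`. -/
def traceNorm {X : Type} [Fintype X] [DecidableEq X] (A : Op X) : ℝ :=
  (cfc Real.sqrt (Aᴴ * A)).trace.re

/-- The diamond distance `‖Φ - Ψ‖_⋄`: the supremum, over all finite-dimensional reference systems
`r` and all states `ρ_ar`, of `‖(Φ ⊗ id)(ρ_ar) - (Ψ ⊗ id)(ρ_ar)‖`. -/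
def diamondDist {X Y : Type} [Fintype X] [Fintype Y] [DecidableEq Y]
    (Φ Ψ : SuperOp X Y) : ℝ :=
  sSup {t : ℝ | ∃ (k : ℕ) (ρ : Op (X × Fin k)), IsDensity ρ ∧
    t = traceNorm (tensorId Φ (Fin k) ρ - tensorId Ψ (Fin k) ρ)}

/-! ### Maximally entangled states, Choi matrices, tensor powers -/

/-- The vector `|Φ⟩ = d^{-1/2} ∑ₖ |k⟩|k⟩`. -/
def maxEntVec (d : ℕ) : Fin d × Fin d → ℂ :=
  fun p => if p.1 = p.2 then (((Real.sqrt d)⁻¹ : ℝ) : ℂ) else 0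

/-- The maximally entangled state `|Φ⟩⟨Φ|` of two `d`-dimensional systems. -/
def maxEnt (d : ℕ) : Op (Fin d × Fin d) :=
  Matrix.vecMulVec (maxEntVec d) (star (maxEntVec d))

/-- The (normalized) Choi matrix `ρ_E = (id ⊗ E)(|Φ⟩⟨Φ|)`. -/
def choi {d d' : ℕ} (E : SuperOp (Fin d) (Fin d')) : Op (Fin d × Fin d') :=
  idTensor (Fin d) E (maxEnt d)

/-- The tensor power `ρ^{⊗ N}` of a bipartite operator `ρ` on `X × Y`, as an operator on the
composite of the `N` copies of `X` and the `N` copies of `Y`. -/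
def biPow {X Y : Type} (N : ℕ) (ρ : Op (X × Y)) : Op ((Fin N → X) × (Fin N → Y)) :=
  Matrix.of fun f g => ∏ i, ρ (f.1 i, f.2 i) (g.1 i, g.2 i)

/-! ### Port-based teleportation

The input qudit `C` and Alice's qudits `A₁, …, A_M` are labelled by
`Fin d × (Fin M → Fin d)`, Bob's ports `B₁, …, B_M` by `Fin M → Fin d`. -/

/-- The state `σ^i = |Φ⟩⟨Φ|_{A_i C} ⊗ 𝟙 / d^{M-1}`, where the identity acts on the `A_j` with
`j ≠ i`. -/
def portState (d M : ℕ) (i : Fin M) : Op (Fin d × (Fin M → Fin d)) :=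
  Matrix.of fun p q =>
    if ∀ j, j ≠ i → p.2 j = q.2 j then
      maxEnt d (p.2 i, p.1) (q.2 i, q.1) * ((d : ℂ) ^ (M - 1))⁻¹
    else 0

/-- The operator `ρ = ∑ᵢ σ^i`. -/
def portSum (d M : ℕ) : Op (Fin d × (Fin M → Fin d)) := ∑ i, portState d M i

/-- The inverse square root of a positive operator, taken on its support
(the eigenvalue `0` is sent to `0`). -/
def invSqrt {X : Type} [Fintype X] [DecidableEq X] (A : Op X) : Op X :=
  cfc (fun x : ℝ => (Real.sqrt x)⁻¹) A

/-- The square-root measurement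
`Π^i = ρ^{-1/2} σ^i ρ^{-1/2} + M⁻¹ (𝟙 - ρ^{-1/2} ρ ρ^{-1/2})`. -/
def povm (d M : ℕ) (i : Fin M) : Op (Fin d × (Fin M → Fin d)) :=
  invSqrt (portSum d M) * portState d M i * invSqrt (portSum d M)
    + (M : ℂ)⁻¹ • (1 - invSqrt (portSum d M) * portSum d M * invSqrt (portSum d M))

/-- Partial trace over the first factor. -/
def traceFst {X Y : Type} [Fintype X] (ρ : Op (X × Y)) : Op Y :=
  Matrix.of fun y y' => ∑ x, ρ (x, y) (x, y')

/-- Partial trace over all ports but the `i`-th one. -/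
def traceOtherPorts {X : Type} [Fintype X] [DecidableEq X] {M : ℕ} (i : Fin M)
    (ρ : Op (Fin M → X)) : Op X :=
  Matrix.of fun x x' => ∑ f : Fin M → X, if f i = x then ρ f (Function.update f i x') else 0

/-- The operator `ρ_C ⊗ |Φ⟩⟨Φ|_{AB}^{⊗ M}`, with the systems grouped as `(C A) B`. -/
def pbtInput (d M : ℕ) (ρ : Op (Fin d)) :
    Op ((Fin d × (Fin M → Fin d)) × (Fin M → Fin d)) :=
  (ρ ⊗ₖ biPow M (maxEnt d)).submatrix (Equiv.prodAssoc _ _ _) (Equiv.prodAssoc _ _ _)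

/-- The `M`-port PBT channel
`Γ_M(ρ_C) = ∑ᵢ Tr_{A B̄_i C} [Π^i_{CA} (ρ_C ⊗ |Φ⟩⟨Φ|_{AB}^{⊗ M})]`. -/
def pbtChannel (d M : ℕ) : SuperOp (Fin d) (Fin d) where
  toFun ρ := ∑ i, traceOtherPorts i
    (traceFst ((povm d M i ⊗ₖ (1 : Op (Fin M → Fin d))) * pbtInput d M ρ))
  map_add' ρ σ := by
    have h : pbtInput d M (ρ + σ) = pbtInput d M ρ + pbtInput d M σ := by
      rw [pbtInput, Matrix.add_kronecker]
      rfl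
    rw [← Finset.sum_add_distrib]
    refine Finset.sum_congr rfl fun i _ => ?_
    rw [h, Matrix.mul_add]
    ext x x'
    simp only [traceOtherPorts, traceFst, Matrix.of_apply, Matrix.add_apply,
      ← Finset.sum_add_distrib]
    refine Finset.sum_congr rfl fun f _ => ?_
    split_ifs <;> simp [Finset.sum_add_distrib]
  map_smul' c ρ := by
    have h : pbtInput d M (c • ρ) = c • pbtInput d M ρ := by
      rw [pbtInput, Matrix.smul_kronecker]
      rfl
    rw [RingHom.id_apply, Finset.smul_sum]
    refine Finset.sum_congr rfl fun i _ => ?_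
    rw [h, Matrix.mul_smul]
    ext x x'
    simp only [traceOtherPorts, traceFst, Matrix.of_apply, Matrix.smul_apply,
      Finset.smul_sum]
    refine Finset.sum_congr rfl fun f _ => ?_
    split_ifs <;> simp [Finset.mul_sum]

/-- The `M`-port simulation error `δ_M = ‖id - Γ_M‖_⋄` in dimension `d`. -/
def pbtError (d M : ℕ) : ℝ := diamondDist LinearMap.id (pbtChannel d M)

/-! ### LOCC -/

/-- Trace-preserving LOCC maps between bipartite systems (Alice's system first, Bob's second):
finite-round protocols in which, in each round, one of the parties applies a local quantum
instrument with finitely many outcomes and broadcasts the outcome `j`, on which everything that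
follows may depend; at the end both parties apply local channels. Summing over `j` is the average
over the outcomes. -/
inductive IsLOCC {A' B' : Type} [Fintype A'] [Fintype B'] :
    ∀ {A B : Type} [Fintype A] [Fintype B], SuperOp (A × B) (A' × B') → Prop
  | loc {A B : Type} [Fintype A] [Fintype B] (Φ : SuperOp A A') (Ψ : SuperOp B B')
      (hΦ : IsChannel Φ) (hΨ : IsChannel Ψ) : IsLOCC (tensorMap Φ Ψ)
  | alice {A B : Type} [Fintype A] [Fintype B] (k : ℕ) (X : Fin k → Type)
      [∀ j, Fintype (X j)] (Φ : ∀ j, SuperOp A (X j)) (hcp : ∀ j, IsCP (Φ j))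
      (htp : ∀ ρ : Op A, ∑ j, (Φ j ρ).trace = ρ.trace)
      (Λ : ∀ j, SuperOp (X j × B) (A' × B')) (hΛ : ∀ j, IsLOCC (Λ j)) :
      IsLOCC (∑ j, Λ j ∘ₗ tensorId (Φ j) B)
  | bob {A B : Type} [Fintype A] [Fintype B] (k : ℕ) (Y : Fin k → Type)
      [∀ j, Fintype (Y j)] (Ψ : ∀ j, SuperOp B (Y j)) (hcp : ∀ j, IsCP (Ψ j))
      (htp : ∀ ρ : Op B, ∑ j, (Ψ j ρ).trace = ρ.trace)
      (Λ : ∀ j, SuperOp (A × Y j) (A' × B')) (hΛ : ∀ j, IsLOCC (Λ j)) :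
      IsLOCC (∑ j, Λ j ∘ₗ idTensor A (Ψ j))

/-! ### Adaptive protocols -/

/-- One use of the channel `E`: the `d`-dimensional system picked from Alice's register
`R × Fin d` is sent through `E`, and the output is merged with Bob's register `C`. -/
def transmit {d d' : ℕ} (E : SuperOp (Fin d) (Fin d')) (R C : Type) :
    SuperOp ((R × Fin d) × C) (R × (C × Fin d')) where
  toFun ρ := Matrix.of fun p q =>
    E (Matrix.of fun x x' => ρ ((p.1, x), p.2.1) ((q.1, x'), q.2.1)) p.2.2 q.2.2
  map_add' ρ σ := by
    ext p q
    exact congrFun (congrFun (map_add E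
      (Matrix.of fun x x' => ρ ((p.1, x), p.2.1) ((q.1, x'), q.2.1))
      (Matrix.of fun x x' => σ ((p.1, x), p.2.1) ((q.1, x'), q.2.1))) p.2.2) q.2.2
  map_smul' c ρ := by
    ext p q
    exact congrFun (congrFun (map_smul E c
      (Matrix.of fun x x' => ρ ((p.1, x), p.2.1) ((q.1, x'), q.2.1))) p.2.2) q.2.2

/-- `AdaptiveProtocol d d' A' B' n A B` is the type of sequences of quantum operations
`Λ₀, …, Λₙ` interleaved with `n` uses of an unspecified channel from dimension `d` to dimension
`d'`. The protocol starts on registers `A` and `B` and ends on registers `A'` and `B'`. The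
registers have arbitrary finite dimensions, which may change from step to step. -/
inductive AdaptiveProtocol (d d' : ℕ) (A' B' : Type) [Fintype A'] [Fintype B'] :
    ℕ → ∀ (A B : Type) [Fintype A] [Fintype B], Type 1
  | last {A B : Type} [Fintype A] [Fintype B] (Λ : SuperOp (A × B) (A' × B'))
      (hΛ : IsChannel Λ) : AdaptiveProtocol d d' A' B' 0 A B
  | step {n : ℕ} {A B : Type} [Fintype A] [Fintype B] (R C : Type) [Fintype R] [Fintype C]
      (Λ : SuperOp (A × B) ((R × Fin d) × C)) (hΛ : IsChannel Λ)
      (rest : AdaptiveProtocol d d' A' B' n R (C × Fin d')) :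
      AdaptiveProtocol d d' A' B' (n + 1) A B

/-- The output `ρₙ = (Λₙ ∘ E ∘ Λₙ₋₁ ∘ ⋯ ∘ E ∘ Λ₀)(ρ)` of the protocol over the channel `E` when
the registers start in the state `ρ`. -/
def AdaptiveProtocol.output {d d' : ℕ} {A' B' : Type} [Fintype A'] [Fintype B']
    (E : SuperOp (Fin d) (Fin d')) : ∀ {n : ℕ} {A B : Type} [Fintype A] [Fintype B],
    AdaptiveProtocol d d' A' B' n A B → Op (A × B) → Op (A' × B')
  | _, _, _, _, _, @AdaptiveProtocol.last _ _ _ _ _ _ _ _ _ _ Λ _, ρ => Λ ρ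
  | _, _, _, _, _, @AdaptiveProtocol.step _ _ _ _ _ _ _ _ _ _ _ R C _ _ Λ _ rest, ρ => rest.output E (transmit E R C (Λ ρ))

/-- All operations `Λ₀, …, Λₙ` of the protocol are LOCCs between the two registers. -/
def AdaptiveProtocol.OpsLOCC {d d' : ℕ} {A' B' : Type} [Fintype A'] [Fintype B'] :
    ∀ {n : ℕ} {A B : Type} [Fintype A] [Fintype B],
    AdaptiveProtocol d d' A' B' n A B → Prop
  | _, _, _, _, _, @AdaptiveProtocol.last _ _ _ _ _ _ _ _ _ _ Λ _ => IsLOCC Λ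
  | _, _, _, _, _, @AdaptiveProtocol.step _ _ _ _ _ _ _ _ _ _ _ _ _ _ _ Λ _ rest => IsLOCC Λ ∧ rest.OpsLOCC

/-- Product states of two registers. -/
def IsProductState {A B : Type} [Fintype A] [Fintype B] (ρ : Op (A × B)) : Prop :=
  ∃ (α : Op A) (β : Op B), IsDensity α ∧ IsDensity β ∧ ρ = α ⊗ₖ β

end PBT

end

noncomputable section

namespace PBT

/-! ### The trace norm of Hermitian operators -/

section TraceNorm

variable {X Y : Type} [Fintype X] [DecidableEq X] [Fintype Y] [DecidableEq Y]

/-! In port-based teleportation Bob's only correction is to keep one port. Since `E` preserves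
traces, applying it to all ports and then keeping the `i`-th one is the same as keeping that port
and then applying `E` (`discardPorts_biPow_choi`). Teleporting over `M` copies of the Choi matrix
therefore realises `E ∘ Γ_M` exactly, by operations that do not involve `E` (`simulate_interleave`).

Replacing one use of `E` by `E ∘ Γ_M` costs at most `δ_M`: the registers that are not sent act as
the reference system of the diamond distance, and `E` and all that follows contract the trace norm
(`traceNorm_transmit_le`). A hybrid argument, by induction on the number of uses with the first use
peeled off, adds up these errors (`exists_stretching`). The initial state is quantified inside the
induction, because the hypothesis is needed at the state left by the simulated first use.

For LOCC protocols, each teleportation is one round in which Alice announces the port, the copies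
not yet consumed are idle local systems (`IsLOCC.comp_simulate`, `IsLOCC.comp_extend`), and a
product initial state is prepared locally (`IsLOCC.comp_interleave`). -/

/-- The spectrum is finite, so the functional calculus accepts every function, including the
discontinuous sign and inverse square root. -/
lemma continuousOn_spectrum (A : Op X) (f : ℝ → ℝ) : ContinuousOn f (spectrum ℝ A) :=
  (Matrix.finite_real_spectrum (A := A)).continuousOn f

open scoped MatrixOrder in
lemma posSemidef_cfc (A : Op X) (f : ℝ → ℝ) (hf : ∀ x ∈ spectrum ℝ A, 0 ≤ f x) :
    (cfc f A).PosSemidef :=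
  Matrix.nonneg_iff_posSemidef.1 (cfc_nonneg hf)

lemma cfc_sqrt_conjTranspose_mul_self {A : Op X} (hA : A.IsHermitian) :
    cfc Real.sqrt (Aᴴ * A) = cfc (fun x : ℝ => |x|) A := by
  have hA' : IsSelfAdjoint A := hA
  have h : Aᴴ * A = cfc (fun x : ℝ => x * x) A := by
    rw [cfc_mul _ _ A (continuousOn_spectrum A _) (continuousOn_spectrum A _), cfc_id' ℝ A, hA.eq]
  rw [h, ← cfc_comp' Real.sqrt (fun x : ℝ => x * x) A
    (((Matrix.finite_real_spectrum (A := A)).image _).continuousOn _) (continuousOn_spectrum A _)]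
  simp only [Real.sqrt_mul_self_eq_abs]

/-- A Hermitian operator is a difference of positive operators whose traces add up to its trace
norm. -/
lemma exists_posSemidef_sub {A : Op X} (hA : A.IsHermitian) :
    ∃ P Q : Op X, P.PosSemidef ∧ Q.PosSemidef ∧ A = P - Q ∧
      traceNorm A = P.trace.re + Q.trace.re := by
  have hA' : IsSelfAdjoint A := hA
  refine ⟨cfc (fun x : ℝ => max x 0) A, cfc (fun x : ℝ => max (-x) 0) A,
    posSemidef_cfc _ _ fun _ _ => le_max_right _ _,
    posSemidef_cfc _ _ fun _ _ => le_max_right _ _, ?_, ?_⟩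
  · rw [← cfc_sub _ _ A (continuousOn_spectrum A _) (continuousOn_spectrum A _)]
    conv_lhs => rw [← cfc_id' ℝ A]
    congr 1
    ext x
    rcases le_total x 0 with h | h <;> simp [h]
  · rw [traceNorm, cfc_sqrt_conjTranspose_mul_self hA, ← Complex.add_re, ← Matrix.trace_add,
      ← cfc_add A _ _ (continuousOn_spectrum A _) (continuousOn_spectrum A _)]
    congr 3
    ext x
    rcases le_total x 0 with h | h <;> simp [h, abs_of_nonneg, abs_of_nonpos]

lemma trace_mul_re_nonneg {A B : Op X} (hA : A.PosSemidef) (hB : B.PosSemidef) :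
    0 ≤ (A * B).trace.re := by
  obtain ⟨C, rfl⟩ : ∃ C : Op X, A = Cᴴ * C := by
    open scoped MatrixOrder in
    exact CStarAlgebra.nonneg_iff_eq_star_mul_self.mp hA.nonneg
  rw [Matrix.mul_assoc, Matrix.trace_mul_comm]
  exact (Complex.nonneg_iff.1 (hB.mul_mul_conjTranspose_same C).trace_nonneg).1

/-- With `s` the sign function, `|A| = s(A) A` and `-1 ≤ s(A) ≤ 1`, so `Tr |P - Q| = Tr s(A)P - Tr
s(A)Q` is at most `Tr P + Tr Q`. Together with `exists_posSemidef_sub` this makes the trace norm the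
minimum of `Tr P + Tr Q` over positive decompositions, from which the triangle inequality and
monotonicity follow. -/
lemma traceNorm_sub_le {P Q : Op X} (hP : P.PosSemidef) (hQ : Q.PosSemidef) :
    traceNorm (P - Q) ≤ P.trace.re + Q.trace.re := by
  set A := P - Q with hAdef
  have hA : A.IsHermitian := hP.1.sub hQ.1
  have hA' : IsSelfAdjoint A := hA
  let s : ℝ → ℝ := fun x => if 0 ≤ x then 1 else -1
  have c := continuousOn_spectrum A
  have habs : cfc (fun x : ℝ => |x|) A = cfc s A * A := by
    conv_rhs => rw [← cfc_id' ℝ A, ← cfc_comp' s (fun x : ℝ => x) A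
      (((Matrix.finite_real_spectrum (A := A)).image _).continuousOn _) (c _)]
    rw [← cfc_mul _ _ A (c _) (c _)]
    congr 1
    ext x
    by_cases h : 0 ≤ x
    · simp [s, h, abs_of_nonneg]
    · simp [s, h, abs_of_neg (not_le.1 h)]
  have h1 : (1 - cfc s A).PosSemidef := by
    rw [← cfc_one ℝ A, ← cfc_sub _ _ A (c _) (c _)]
    refine posSemidef_cfc _ _ fun x _ => ?_
    by_cases h : 0 ≤ x <;> norm_num [s, h]
  have h2 : (1 + cfc s A).PosSemidef := by
    rw [← cfc_one ℝ A, ← cfc_add A _ _ (c _) (c _)]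
    refine posSemidef_cfc _ _ fun x _ => ?_
    by_cases h : 0 ≤ x <;> norm_num [s, h]
  have e1 := trace_mul_re_nonneg h1 hP
  have e2 := trace_mul_re_nonneg h2 hQ
  rw [traceNorm, cfc_sqrt_conjTranspose_mul_self hA, habs, hAdef, mul_sub]
  simp only [sub_mul, add_mul, one_mul, Matrix.trace_sub, Matrix.trace_add, Complex.sub_re,
    Complex.add_re] at e1 e2 ⊢
  rw [← hAdef]
  linarith

lemma traceNorm_add_le {A B : Op X} (hA : A.IsHermitian) (hB : B.IsHermitian) :
    traceNorm (A + B) ≤ traceNorm A + traceNorm B := by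
  obtain ⟨P, Q, hP, hQ, rfl, h⟩ := exists_posSemidef_sub hA
  obtain ⟨P', Q', hP', hQ', rfl, h'⟩ := exists_posSemidef_sub hB
  have := traceNorm_sub_le (hP.add hP') (hQ.add hQ')
  rw [h, h', show P - Q + (P' - Q') = P + P' - (Q + Q') by abel]
  simp only [Matrix.trace_add, Complex.add_re] at this
  linarith

lemma traceNorm_zero : traceNorm (0 : Op X) = 0 := by
  refine le_antisymm ?_ ?_
  · simpa using traceNorm_sub_le (X := X) Matrix.PosSemidef.zero Matrix.PosSemidef.zero
  · obtain ⟨P, Q, hP, hQ, -, h⟩ := exists_posSemidef_sub (Matrix.isHermitian_zero (n := X) (α := ℂ))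
    rw [h]
    exact add_nonneg (Complex.nonneg_iff.1 hP.trace_nonneg).1
      (Complex.nonneg_iff.1 hQ.trace_nonneg).1

/-- The trace norm of Hermitian operators does not increase under positive trace-preserving
maps. -/
lemma traceNorm_map_le {Φ : SuperOp X Y} (hpos : ∀ ρ, ρ.PosSemidef → (Φ ρ).PosSemidef)
    (htr : ∀ ρ, (Φ ρ).trace = ρ.trace) {A : Op X} (hA : A.IsHermitian) :
    traceNorm (Φ A) ≤ traceNorm A := by
  obtain ⟨P, Q, hP, hQ, rfl, h⟩ := exists_posSemidef_sub hA
  rw [h, map_sub, ← htr P, ← htr Q]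
  exact traceNorm_sub_le (hpos P hP) (hpos Q hQ)

end TraceNorm

/-! ### Completely positive maps and channels -/

section CompletelyPositive

/-- Complete positivity is defined with ancillas `Fin k` only; relabelling a basis reaches every
finite ancilla. -/
lemma IsCP.tensorId_posSemidef {X Y R : Type} [Finite R] {Φ : SuperOp X Y} (hΦ : IsCP Φ)
    {ρ : Op (X × R)} (hρ : ρ.PosSemidef) : (tensorId Φ R ρ).PosSemidef := by
  obtain ⟨k, ⟨e⟩⟩ := Finite.exists_equiv_fin R
  have h := (hΦ k _ (hρ.submatrix (Prod.map id e.symm))).submatrix (Prod.map id e)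
  convert h using 1
  ext p q
  simp [tensorId]

/-- A map which acts entrywise like `Φ`, the remaining labels being carried along, is completely
positive if `Φ` is. -/
lemma IsCP.of_apply {X Y R X' Y' : Type} [Finite R] {Φ : SuperOp X Y} (hΦ : IsCP Φ)
    {Ψ : SuperOp X' Y'} (u : Y' → Y) (w : Y' → R) (v : X → R → X')
    (h : ∀ ρ y y', Ψ ρ y y' = Φ (Matrix.of fun x x' => ρ (v x (w y)) (v x' (w y'))) (u y) (u y')) :
    IsCP Ψ := by
  intro k ρ hρ
  have := (hΦ.tensorId_posSemidef (R := R × Fin k)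
    (hρ.submatrix fun p : X × (R × Fin k) => (v p.1 p.2.1, p.2.2))).submatrix
      fun p : Y' × Fin k => (u p.1, (w p.1, p.2))
  convert this using 1
  ext p q
  exact h _ _ _

lemma IsCP.comp {X Y Z : Type} {Ψ : SuperOp Y Z} {Φ : SuperOp X Y} (hΨ : IsCP Ψ) (hΦ : IsCP Φ) :
    IsCP (Ψ ∘ₗ Φ) :=
  fun k ρ hρ => hΨ k _ (hΦ k ρ hρ)

lemma tensorId_sum {X Y ι : Type} (s : Finset ι) (Φ : ι → SuperOp X Y) (R : Type)
    (ρ : Op (X × R)) : tensorId (∑ i ∈ s, Φ i) R ρ = ∑ i ∈ s, tensorId (Φ i) R ρ := by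
  ext p q
  simp [tensorId, Matrix.sum_apply]

lemma IsCP.sum {X Y ι : Type} (s : Finset ι) {Φ : ι → SuperOp X Y} (h : ∀ i, IsCP (Φ i)) :
    IsCP (∑ i ∈ s, Φ i) := by
  intro k ρ hρ
  rw [tensorId_sum]
  exact Matrix.posSemidef_sum _ fun i _ => h i k ρ hρ

lemma IsCP.tensorId {X Y : Type} {Φ : SuperOp X Y} (hΦ : IsCP Φ) (R : Type) [Finite R] :
    IsCP (tensorId Φ R) :=
  hΦ.of_apply Prod.fst Prod.snd Prod.mk fun _ _ _ => rfl

lemma IsCP.idTensor {X Y : Type} {Φ : SuperOp X Y} (hΦ : IsCP Φ) (R : Type) [Finite R] :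
    IsCP (idTensor R Φ) :=
  hΦ.of_apply Prod.snd Prod.fst (fun x r => (r, x)) fun _ _ _ => rfl

lemma IsCP.posSemidef {X Y : Type} {Φ : SuperOp X Y} (hΦ : IsCP Φ) {ρ : Op X}
    (hρ : ρ.PosSemidef) : (Φ ρ).PosSemidef :=
  (hΦ.tensorId_posSemidef (R := Unit) (hρ.submatrix Prod.fst)).submatrix fun y => (y, ())

/-- Relabelling of basis vectors. -/
def relabel {X Y : Type} (e : Y → X) : SuperOp X Y where
  toFun ρ := ρ.submatrix e e
  map_add' _ _ := rfl
  map_smul' _ _ := rfl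

/-- A submatrix with repeated or omitted indices is still positive, so `e` need not be bijective.
Non-bijective relabellings play the role of single Kraus terms, as in `isChannel_discardPorts`. -/
lemma isCP_relabel {X Y : Type} (e : Y → X) : IsCP (relabel e) :=
  fun _ _ hρ => hρ.submatrix (Prod.map e id)

/-- The functional `ρ ↦ Tr (E ρ)`, as a map to the operators of a trivial system. -/
def effect {S : Type} [Fintype S] (E : Op S) : SuperOp S Unit where
  toFun ρ := Matrix.of fun _ _ => ∑ s, ∑ t, E t s * ρ s t
  map_add' ρ σ := by
    ext
    simp [mul_add, Finset.sum_add_distrib]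
  map_smul' c ρ := by
    ext
    simp [mul_left_comm, Finset.mul_sum]

lemma isCP_effect {S : Type} [Fintype S] {E : Op S} (hE : E.PosSemidef) : IsCP (effect E) := by
  classical
  intro k ρ hρ
  obtain ⟨K, rfl⟩ : ∃ K : Op S, E = Kᴴ * K := by
    open scoped MatrixOrder in
    exact CStarAlgebra.nonneg_iff_eq_star_mul_self.mp hE.nonneg
  obtain ⟨B, rfl⟩ : ∃ B : Op (S × Fin k), ρ = Bᴴ * B := by
    open scoped MatrixOrder in
    exact CStarAlgebra.nonneg_iff_eq_star_mul_self.mp hρ.nonneg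
  -- Factoring both the effect and the state turns the output into the Gram matrix of `C`.
  let C : Matrix (S × (S × Fin k)) (Unit × Fin k) ℂ :=
    Matrix.of fun p q => ∑ s, star (K p.1 s) * B p.2 (s, q.2)
  convert Matrix.posSemidef_conjTranspose_mul_self C using 1
  ext p q
  simp only [effect, PBT.tensorId, LinearMap.coe_mk, AddHom.coe_mk, Matrix.of_apply,
    Matrix.mul_apply, Matrix.conjTranspose_apply, C, star_sum, star_mul', star_star,
    Finset.sum_mul_sum, ← Fintype.sum_prod_type']
  refine Fintype.sum_equiv (Equiv.prodComm _ _) _ _ fun x => ?_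
  simp only [Equiv.prodComm_apply, Prod.fst_swap, Prod.snd_swap]
  ring

lemma IsChannel.comp {X Y Z : Type} [Fintype X] [Fintype Y] [Fintype Z] {Ψ : SuperOp Y Z}
    {Φ : SuperOp X Y} (hΨ : IsChannel Ψ) (hΦ : IsChannel Φ) : IsChannel (Ψ ∘ₗ Φ) :=
  ⟨hΨ.cp.comp hΦ.cp, fun ρ => (hΨ.tp _).trans (hΦ.tp ρ)⟩

lemma IsChannel.posSemidef {X Y : Type} [Fintype X] [Fintype Y] {Φ : SuperOp X Y}
    (hΦ : IsChannel Φ) {ρ : Op X} (hρ : ρ.PosSemidef) : (Φ ρ).PosSemidef :=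
  hΦ.cp.posSemidef hρ

lemma IsChannel.isDensity {X Y : Type} [Fintype X] [Fintype Y] {Φ : SuperOp X Y}
    (hΦ : IsChannel Φ) {ρ : Op X} (hρ : IsDensity ρ) : IsDensity (Φ ρ) :=
  ⟨hΦ.posSemidef hρ.pos, (hΦ.tp ρ).trans hρ.trace_one⟩

lemma isChannel_relabel {X Y : Type} [Fintype X] [Fintype Y] (e : Y ≃ X) :
    IsChannel (relabel e : SuperOp X Y) :=
  ⟨isCP_relabel e, fun ρ => Equiv.sum_comp e fun x => ρ x x⟩

lemma trace_tensorId {X Y R : Type} [Fintype X] [Fintype Y] [Fintype R] (Φ : SuperOp X Y)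
    (ρ : Op (X × R)) :
    (tensorId Φ R ρ).trace = ∑ r, (Φ (Matrix.of fun x x' => ρ (x, r) (x', r))).trace :=
  Fintype.sum_prod_type_right fun p => tensorId Φ R ρ p p

lemma trace_idTensor {X Y R : Type} [Fintype X] [Fintype Y] [Fintype R] (Φ : SuperOp X Y)
    (ρ : Op (R × X)) :
    (idTensor R Φ ρ).trace = ∑ r, (Φ (Matrix.of fun x x' => ρ (r, x) (r, x'))).trace :=
  Fintype.sum_prod_type fun p => idTensor R Φ ρ p p

lemma sum_trace_slice_fst {X R : Type} [Fintype X] [Fintype R] (ρ : Op (X × R)) :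
    ∑ r, (Matrix.of fun x x' => ρ (x, r) (x', r)).trace = ρ.trace :=
  (Fintype.sum_prod_type_right fun p => ρ p p).symm

lemma sum_trace_slice_snd {X R : Type} [Fintype X] [Fintype R] (ρ : Op (R × X)) :
    ∑ r, (Matrix.of fun x x' => ρ (r, x) (r, x')).trace = ρ.trace :=
  (Fintype.sum_prod_type fun p => ρ p p).symm

lemma IsChannel.tensorId {X Y : Type} [Fintype X] [Fintype Y] {Φ : SuperOp X Y}
    (hΦ : IsChannel Φ) (R : Type) [Fintype R] : IsChannel (tensorId Φ R) := by
  refine ⟨hΦ.cp.tensorId R, fun ρ => ?_⟩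
  simp only [trace_tensorId, hΦ.tp, sum_trace_slice_fst]

lemma IsChannel.idTensor {X Y : Type} [Fintype X] [Fintype Y] {Φ : SuperOp X Y}
    (hΦ : IsChannel Φ) (R : Type) [Fintype R] : IsChannel (idTensor R Φ) := by
  refine ⟨hΦ.cp.idTensor R, fun ρ => ?_⟩
  simp only [trace_idTensor, hΦ.tp, sum_trace_slice_snd]

/-- Adjunction of a system in the state `τ`. -/
def attach {X : Type} (τ : Op X) (Z : Type) : SuperOp Z (X × Z) where
  toFun σ := τ ⊗ₖ σ
  map_add' _ _ := Matrix.kronecker_add _ _ _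
  map_smul' _ _ := Matrix.kronecker_smul _ _ _

lemma isChannel_attach {X : Type} [Fintype X] {τ : Op X} (hτ : IsDensity τ) (Z : Type)
    [Fintype Z] : IsChannel (attach τ Z) := by
  refine ⟨fun k ρ hρ => ?_, fun ρ => ?_⟩
  · exact (hτ.pos.kronecker hρ).submatrix (Equiv.prodAssoc X Z (Fin k))
  · exact (Matrix.trace_kronecker τ ρ).trans (by rw [hτ.trace_one, one_mul])

lemma traceNorm_channel_le {X Y : Type} [Fintype X] [Fintype Y] [DecidableEq X] [DecidableEq Y]
    {Φ : SuperOp X Y} (hΦ : IsChannel Φ) {A : Op X} (hA : A.IsHermitian) :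
    traceNorm (Φ A) ≤ traceNorm A :=
  traceNorm_map_le (fun _ => hΦ.posSemidef) hΦ.tp hA

lemma isChannel_transmit {d d' : ℕ} {E : SuperOp (Fin d) (Fin d')} (hE : IsChannel E)
    (R C : Type) [Fintype R] [Fintype C] : IsChannel (transmit E R C) :=
  (isChannel_relabel (⟨fun p => (p.2.2, (p.1, p.2.1)), fun q => (q.2.1, (q.2.2, q.1)),
    fun _ => rfl, fun _ => rfl⟩ : R × (C × Fin d') ≃ Fin d' × (R × C))).comp
  ((hE.tensorId (R × C)).comp (isChannel_relabel
    (⟨fun p => ((p.2.1, p.1), p.2.2), fun q => (q.1.2, (q.1.1, q.2)),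
      fun _ => rfl, fun _ => rfl⟩ : Fin d × (R × C) ≃ (R × Fin d) × C)))

end CompletelyPositive

/-! ### Composition of LOCC maps -/

section LOCC

variable {A B A' B' : Type} [Fintype A] [Fintype B] [Fintype A'] [Fintype B']

/-- A local channel is an instrument with a single outcome. -/
lemma IsLOCC.comp_tensorId {X : Type} [Fintype X] {Φ : SuperOp A X} (hΦ : IsChannel Φ)
    {Λ : SuperOp (X × B) (A' × B')} (hΛ : IsLOCC Λ) : IsLOCC (Λ ∘ₗ tensorId Φ B) := by
  simpa using IsLOCC.alice 1 (fun _ => X) (fun _ => Φ) (fun _ => hΦ.cp) (by simp [hΦ.tp])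
    (fun _ => Λ) (fun _ => hΛ)

lemma IsLOCC.comp_idTensor {Y : Type} [Fintype Y] {Ψ : SuperOp B Y} (hΨ : IsChannel Ψ)
    {Λ : SuperOp (A × Y) (A' × B')} (hΛ : IsLOCC Λ) : IsLOCC (Λ ∘ₗ idTensor A Ψ) := by
  simpa using IsLOCC.bob 1 (fun _ => Y) (fun _ => Ψ) (fun _ => hΨ.cp) (by simp [hΨ.tp])
    (fun _ => Λ) (fun _ => hΛ)

/-- `Λ ⊗ id`, where Alice holds a further system `G` and Bob a further system `H`. -/
def extend {A B A' B' : Type} (Λ : SuperOp (A × B) (A' × B')) (G H : Type) :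
    SuperOp ((A × G) × (B × H)) ((A' × G) × (B' × H)) :=
  relabel (Equiv.prodProdProdComm A' G B' H) ∘ₗ tensorId Λ (G × H) ∘ₗ
    relabel (Equiv.prodProdProdComm A B G H)

lemma isChannel_extend {Λ : SuperOp (A × B) (A' × B')} (hΛ : IsChannel Λ) (G H : Type)
    [Fintype G] [Fintype H] : IsChannel (extend Λ G H) :=
  (isChannel_relabel _).comp ((hΛ.tensorId _).comp (isChannel_relabel _))

lemma extend_sum {A B A' B' ι : Type} (s : Finset ι) (Λ : ι → SuperOp (A × B) (A' × B'))
    (G H : Type) : extend (∑ i ∈ s, Λ i) G H = ∑ i ∈ s, extend (Λ i) G H := by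
  refine LinearMap.ext fun ρ => ?_
  simp only [extend, LinearMap.comp_apply, tensorId_sum, map_sum, LinearMap.sum_apply]

/-- Induction on the rounds of `Λ` pushes `L` behind them; the final local channels of `Λ` become
one-outcome rounds preceding `L`. The systems `G` and `H` are idle during `Λ` but available to `L`,
as is needed for the resource copies waiting to be used. -/
lemma IsLOCC.comp_extend {Λ : SuperOp (A × B) (A' × B')} (hΛ : IsLOCC Λ) {G H : Type}
    [Fintype G] [Fintype H] {A'' B'' : Type} [Fintype A''] [Fintype B'']
    {L : SuperOp ((A' × G) × (B' × H)) (A'' × B'')} (hL : IsLOCC L) :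
    IsLOCC (L ∘ₗ extend Λ G H) := by
  induction hΛ with
  | loc Φ Ψ hΦ hΨ =>
    exact (hL.comp_tensorId (hΦ.tensorId G)).comp_idTensor (hΨ.tensorId H)
  | alice k X Φ hcp htp Λ hΛ ih =>
    have := IsLOCC.alice k _ (fun j => tensorId (Φ j) G) (fun j => (hcp j).tensorId G)
      (fun ρ => by
        simp only [trace_tensorId]
        rw [Finset.sum_comm]
        simp only [htp, sum_trace_slice_fst]) (fun j => L ∘ₗ extend (Λ j) G H) ih
    convert this using 1
    refine LinearMap.ext fun ρ => ?_
    simp only [LinearMap.comp_apply, extend_sum, LinearMap.sum_apply, map_sum]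
    rfl
  | bob k Y Ψ hcp htp Λ hΛ ih =>
    have := IsLOCC.bob k _ (fun j => tensorId (Ψ j) H) (fun j => (hcp j).tensorId H)
      (fun ρ => by
        simp only [trace_tensorId]
        rw [Finset.sum_comm]
        simp only [htp, sum_trace_slice_fst]) (fun j => L ∘ₗ extend (Λ j) G H) ih
    convert this using 1
    refine LinearMap.ext fun ρ => ?_
    simp only [LinearMap.comp_apply, extend_sum, LinearMap.sum_apply, map_sum]
    rfl

end LOCC

/-! ### The port-based teleportation measurement -/

section Measurement

lemma posSemidef_maxEnt (d : ℕ) : (maxEnt d).PosSemidef :=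
  Matrix.posSemidef_vecMulVec_self_star _

lemma trace_maxEnt {d : ℕ} (hd : 1 ≤ d) : (maxEnt d).trace = 1 := by
  have hd' : (d : ℝ) ≠ 0 := by positivity
  have h : ((Real.sqrt d)⁻¹ * (Real.sqrt d)⁻¹ : ℝ) = (d : ℝ)⁻¹ := by
    rw [← mul_inv, Real.mul_self_sqrt (Nat.cast_nonneg d)]
  simp only [Matrix.trace, Matrix.diag, maxEnt, Matrix.vecMulVec_apply, maxEntVec, Pi.star_apply,
    Fintype.sum_prod_type]
  simp only [apply_ite star, star_zero, mul_ite, ite_mul, zero_mul, mul_zero, Finset.sum_ite_eq,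
    Finset.mem_univ, if_true, Complex.star_def, Complex.conj_ofReal, ← Complex.ofReal_mul, h]
  simp [show (d : ℂ) ≠ 0 by exact_mod_cast hd']

lemma posSemidef_portState (d M : ℕ) (i : Fin M) : (portState d M i).PosSemidef := by
  have h := (((posSemidef_maxEnt d).kronecker
    (Matrix.PosSemidef.one (n := {j : Fin M // j ≠ i} → Fin d) (R := ℂ))).smul
      (show 0 ≤ ((d : ℝ) ^ (M - 1))⁻¹ by positivity)).submatrix
      fun p : Fin d × (Fin M → Fin d) => ((p.2 i, p.1), fun j : {j : Fin M // j ≠ i} => p.2 j)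
  refine (congrArg Matrix.PosSemidef ?_).mp h
  ext p q
  simp only [portState, Matrix.of_apply, Matrix.submatrix_apply, Matrix.smul_apply,
    Matrix.kronecker_apply, Matrix.one_apply, funext_iff, Subtype.forall]
  split_ifs
  · simp [mul_comm]
  · simp

lemma isHermitian_invSqrt {X : Type} [Fintype X] [DecidableEq X] (A : Op X) :
    (invSqrt A).IsHermitian :=
  cfc_predicate _ A

/-- On eigenvalues, `x^{-1/2} x x^{-1/2}` is `1` for `x > 0` and, by the convention `0⁻¹ = 0`, it is
`0` at `x = 0`. The difference is thus the projection onto the kernel. -/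
lemma posSemidef_one_sub_invSqrt {X : Type} [Fintype X] [DecidableEq X] {A : Op X}
    (hA : A.PosSemidef) : (1 - invSqrt A * A * invSqrt A).PosSemidef := by
  have hA' : IsSelfAdjoint A := hA.1
  have c := continuousOn_spectrum A
  have h : invSqrt A * A * invSqrt A =
      cfc (fun x : ℝ => (Real.sqrt x)⁻¹ * x * (Real.sqrt x)⁻¹) A := by
    rw [cfc_mul _ _ A (c _) (c _), cfc_mul _ _ A (c _) (c _), cfc_id' ℝ A, invSqrt]
  rw [h, ← cfc_one ℝ A, ← cfc_sub _ _ A (c _) (c _)]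
  refine posSemidef_cfc _ _ fun x hx => ?_
  have hx0 : 0 ≤ x := by
    open scoped MatrixOrder in
    exact spectrum_nonneg_of_nonneg hA.nonneg hx
  rcases hx0.eq_or_lt with rfl | hpos
  · simp
  · have hs : 0 < Real.sqrt x := Real.sqrt_pos.2 hpos
    have : (Real.sqrt x)⁻¹ * x * (Real.sqrt x)⁻¹ = 1 := by
      field_simp
      exact (Real.sq_sqrt hx0).symm
    simp [this]

lemma posSemidef_povm (d M : ℕ) (i : Fin M) : (povm d M i).PosSemidef := by
  refine Matrix.PosSemidef.add ?_ ?_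
  · have := (posSemidef_portState d M i).mul_mul_conjTranspose_same (invSqrt (portSum d M))
    rwa [isHermitian_invSqrt] at this
  · have h := (posSemidef_one_sub_invSqrt
      (Matrix.posSemidef_sum Finset.univ fun j _ => posSemidef_portState d M j)).smul
      (show 0 ≤ ((M : ℝ))⁻¹ by positivity)
    convert h using 1
    ext p q
    simp [portSum]

/-- The `M` equal shares of the kernel projection add up to exactly what the square-root terms lack.
-/
lemma sum_povm (d : ℕ) {M : ℕ} (hM : 1 ≤ M) : ∑ i, povm d M i = 1 := by
  have hM' : (M : ℂ) ≠ 0 := by exact_mod_cast (by omega : M ≠ 0)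
  simp only [povm, Finset.sum_add_distrib, ← Finset.sum_mul, ← Finset.mul_sum]
  rw [← portSum, Finset.sum_const, Finset.card_univ, Fintype.card_fin, ← Nat.cast_smul_eq_nsmul ℂ,
    smul_smul, mul_inv_cancel₀ hM', one_smul, add_sub_cancel]

lemma sum_trace_effect {S ι : Type} [Fintype S] [DecidableEq S] [Fintype ι] {E : ι → Op S}
    (hE : ∑ i, E i = 1) (ρ : Op S) : ∑ i, (effect (E i) ρ).trace = ρ.trace := by
  have h : ∀ i, (effect (E i) ρ).trace = (ρ * E i).trace := fun i => by
    simp [Matrix.trace, effect, Matrix.mul_apply, mul_comm]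
  simp only [h]
  rw [← Matrix.trace_sum, ← Matrix.mul_sum, hE, mul_one]

end Measurement

/-! ### Discarding ports -/

section Ports

/-- Partial trace over all ports but the `i`-th one, as a linear map. -/
def discardPorts {X : Type} [Fintype X] [DecidableEq X] {M : ℕ} (i : Fin M) :
    SuperOp (Fin M → X) X where
  toFun := traceOtherPorts i
  map_add' ρ σ := by
    ext x x'
    simp [traceOtherPorts, ← Finset.sum_add_distrib, ← ite_add_zero]
  map_smul' c ρ := by
    ext x x'
    simp [traceOtherPorts, Finset.mul_sum]

/-- Splitting `f` into its value at `i` and the rest exhibits the partial trace as a sum of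
submatrices, hence as completely positive. -/
lemma discardPorts_apply {X : Type} [Fintype X] [DecidableEq X] {M : ℕ} (i : Fin M)
    (ρ : Op (Fin M → X)) (x x' : X) :
    discardPorts i ρ x x' = ∑ g : {j // j ≠ i} → X,
      ρ ((Equiv.funSplitAt i X).symm (x, g)) ((Equiv.funSplitAt i X).symm (x', g)) := by
  change ∑ f : Fin M → X, (if f i = x then ρ f (Function.update f i x') else 0) = _
  rw [← Equiv.sum_comp (Equiv.funSplitAt i X).symm, Fintype.sum_prod_type]
  have h : ∀ (z : X) (g : {j // j ≠ i} → X), (Equiv.funSplitAt i X).symm (z, g) i = z := by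
    intro z g
    simp [Equiv.funSplitAt]
  have h' : ∀ (z z' : X) (g : {j // j ≠ i} → X),
      Function.update ((Equiv.funSplitAt i X).symm (z, g)) i z' =
        (Equiv.funSplitAt i X).symm (z', g) := by
    intro z z' g
    ext j
    by_cases hj : j = i
    · subst hj
      simp [Equiv.funSplitAt]
    · simp [Equiv.funSplitAt, hj]
  simp only [h, h']
  rw [Finset.sum_comm]
  simp

lemma isChannel_discardPorts {X : Type} [Fintype X] [DecidableEq X] {M : ℕ} (i : Fin M) :
    IsChannel (discardPorts i : SuperOp (Fin M → X) X) := by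
  constructor
  · have h : (discardPorts i : SuperOp (Fin M → X) X) = ∑ g : {j // j ≠ i} → X,
        relabel fun x => (Equiv.funSplitAt i X).symm (x, g) := by
      refine LinearMap.ext fun ρ => ?_
      ext x x'
      rw [discardPorts_apply, LinearMap.sum_apply, Matrix.sum_apply]
      rfl
    rw [h]
    exact IsCP.sum _ fun g => isCP_relabel _
  · intro ρ
    simp only [Matrix.trace, Matrix.diag, discardPorts_apply]
    rw [← Fintype.sum_prod_type']
    exact Equiv.sum_comp (Equiv.funSplitAt i X).symm fun f => ρ f f

lemma discardPorts_prod {X : Type} [Fintype X] [DecidableEq X] {M : ℕ} (i : Fin M)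
    (K : Fin M → Op X) :
    discardPorts i (Matrix.of fun f f' => ∏ j, K j (f j) (f' j)) =
      (∏ j : {j // j ≠ i}, (K j).trace) • K i := by
  ext x x'
  rw [discardPorts_apply]
  simp only [Matrix.of_apply, Matrix.smul_apply, smul_eq_mul, Matrix.trace, Matrix.diag]
  rw [Finset.prod_univ_sum, Fintype.piFinset_univ, Finset.sum_mul]
  refine Finset.sum_congr rfl fun g _ => ?_
  rw [Fintype.prod_eq_mul_prod_subtype_ne _ i, mul_comm]
  congr 1
  · refine Finset.prod_congr rfl fun j _ => ?_
    simp [Equiv.funSplitAt, j.2]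
  · simp [Equiv.funSplitAt]

end Ports

/-! ### Products of bipartite operators -/

section Interleave

/-- The product of operators on `A × B` and on `G × H`, grouped as `(A G) (B H)`. -/
def interleave {A B G H : Type} (ρ : Op (A × B)) (σ : Op (G × H)) : Op ((A × G) × (B × H)) :=
  relabel (Equiv.prodProdProdComm A G B H) (ρ ⊗ₖ σ)

lemma trace_interleave {A B G H : Type} [Fintype A] [Fintype B] [Fintype G] [Fintype H]
    (ρ : Op (A × B)) (σ : Op (G × H)) : (interleave ρ σ).trace = ρ.trace * σ.trace :=
  ((isChannel_relabel _).tp _).trans (Matrix.trace_kronecker ρ σ)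

lemma posSemidef_interleave {A B G H : Type} [Finite A] [Finite B] [Finite G] [Finite H]
    {ρ : Op (A × B)} {σ : Op (G × H)} (hρ : ρ.PosSemidef) (hσ : σ.PosSemidef) :
    (interleave ρ σ).PosSemidef := by
  have := Fintype.ofFinite A
  have := Fintype.ofFinite B
  have := Fintype.ofFinite G
  have := Fintype.ofFinite H
  exact (hρ.kronecker hσ).submatrix _

lemma extend_interleave {A B A' B' G H : Type} (Λ : SuperOp (A × B) (A' × B')) (ρ : Op (A × B))
    (σ : Op (G × H)) : extend Λ G H (interleave ρ σ) = interleave (Λ ρ) σ := by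
  ext p q
  have h : (Matrix.of fun x x' : A × B => interleave ρ σ ((x.1, p.1.2), (x.2, p.2.2))
      ((x'.1, q.1.2), (x'.2, q.2.2))) = σ (p.1.2, p.2.2) (q.1.2, q.2.2) • ρ := by
    ext x x'
    exact mul_comm _ _
  change Λ (Matrix.of fun x x' : A × B => interleave ρ σ ((x.1, p.1.2), (x.2, p.2.2))
      ((x'.1, q.1.2), (x'.2, q.2.2))) (p.1.1, p.2.1) (q.1.1, q.2.1) = _
  rw [h, map_smul]
  exact mul_comm _ _

lemma trace_biPow {X Y : Type} [Fintype X] [Fintype Y] (N : ℕ) (ρ : Op (X × Y)) :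
    (biPow N ρ).trace = ρ.trace ^ N := by
  have h : ρ.trace ^ N = ∏ _i : Fin N, ∑ x, ρ x x := by simp [Matrix.trace]
  rw [h, Finset.prod_univ_sum, Fintype.piFinset_univ]
  exact (Equiv.sum_comp (Equiv.arrowProdEquivProdArrow (Fin N) (fun _ => X) (fun _ => Y))
    fun p => biPow N ρ p p).symm

lemma posSemidef_biPow_maxEnt (d N : ℕ) : (biPow N (maxEnt d)).PosSemidef := by
  have h : biPow N (maxEnt d) = Matrix.vecMulVec
      (fun f : (Fin N → Fin d) × (Fin N → Fin d) => ∏ i, maxEntVec d (f.1 i, f.2 i))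
      (star fun f : (Fin N → Fin d) × (Fin N → Fin d) => ∏ i, maxEntVec d (f.1 i, f.2 i)) := by
    ext f g
    simp [biPow, maxEnt, Matrix.vecMulVec_apply, Finset.prod_mul_distrib]
  rw [h]
  exact Matrix.posSemidef_vecMulVec_self_star _

/-- Concatenation of two families of labels along a splitting of the index set. -/
def joinPorts {N K L : ℕ} (e : Fin N ⊕ Fin K ≃ Fin L) (X : Type) :
    (Fin N → X) × (Fin K → X) ≃ (Fin L → X) :=
  (Equiv.sumArrowEquivProdArrow _ _ _).symm.trans (e.arrowCongr (Equiv.refl X))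

lemma relabel_joinPorts_biPow {X Y : Type} {N K L : ℕ} (e : Fin N ⊕ Fin K ≃ Fin L)
    (ρ : Op (X × Y)) :
    relabel (Prod.map (joinPorts e X) (joinPorts e Y)) (biPow L ρ) =
      interleave (biPow N ρ) (biPow K ρ) := by
  ext p q
  change (∏ i : Fin L, (_ : ℂ)) = (∏ i : Fin N, (_ : ℂ)) * ∏ i : Fin K, (_ : ℂ)
  rw [← Equiv.prod_comp e, Fintype.prod_sum_type]
  simp [joinPorts, Equiv.arrowCongr, Equiv.sumArrowEquivProdArrow]

end Interleave

/-! ### Teleportation simulation of one use of a channel -/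

section Simulation

variable {d d' : ℕ}

/-- The block of the maximally entangled state at the entry `(a, a')` of its first system. -/
def entSlice (d : ℕ) (a a' : Fin d) : Op (Fin d) :=
  Matrix.of fun x x' => maxEnt d (a, x) (a', x')

/-- The coefficients with which the post-measurement slices contribute to the output. -/
def portWeight (d M : ℕ) (i : Fin M) (s t : Fin d × (Fin M → Fin d)) : ℂ :=
  povm d M i t s * ∏ j : {j // j ≠ i}, (entSlice d (s.2 j) (t.2 j)).trace

/-- A slice of the Choi copies at Alice's labels is a product over ports of `E (entSlice ..)`. The
discarded ports enter only through traces, from which `E` drops out; the scalar factor is therefore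
independent of `E`. -/
lemma discardPorts_biPow_choi {M : ℕ} {E : SuperOp (Fin d) (Fin d')}
    (hE : ∀ ρ, (E ρ).trace = ρ.trace) (i : Fin M) (a a' : Fin M → Fin d) :
    discardPorts i (Matrix.of fun f f' => biPow M (choi E) (a, f) (a', f')) =
      (∏ j : {j // j ≠ i}, (entSlice d (a j) (a' j)).trace) • E (entSlice d (a i) (a' i)) := by
  refine (discardPorts_prod i fun j => E (entSlice d (a j) (a' j))).trans ?_
  simp only [hE]

lemma choi_id (d : ℕ) : choi (LinearMap.id : SuperOp (Fin d) (Fin d)) = maxEnt d := rfl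

/-- This expansion lets a linear `E` be applied term by term, so that `E ∘ Γ_M` can be matched with
the simulation over Choi copies. -/
lemma pbtChannel_apply (d M : ℕ) (ρ : Op (Fin d)) :
    pbtChannel d M ρ = ∑ i, ∑ s, ∑ t,
      (portWeight d M i s t * ρ s.1 t.1) • entSlice d (s.2 i) (t.2 i) := by
  change ∑ i, discardPorts i (traceFst ((povm d M i ⊗ₖ (1 : Op (Fin M → Fin d))) *
    pbtInput d M ρ)) = _
  refine Finset.sum_congr rfl fun i _ => ?_
  have h : traceFst ((povm d M i ⊗ₖ (1 : Op (Fin M → Fin d))) * pbtInput d M ρ) =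
      ∑ s, ∑ t, (povm d M i t s * ρ s.1 t.1) •
        Matrix.of fun f f' => biPow M (maxEnt d) (s.2, f) (t.2, f') := by
    ext f f'
    simp only [traceFst, Matrix.of_apply, Matrix.mul_apply, Matrix.kroneckerMap_apply,
      Matrix.sum_apply, Matrix.smul_apply, smul_eq_mul]
    conv_rhs => rw [Finset.sum_comm]
    refine Finset.sum_congr rfl fun t _ => ?_
    rw [Fintype.sum_prod_type]
    refine Finset.sum_congr rfl fun s _ => ?_
    simp only [Matrix.one_apply, mul_ite, ite_mul, mul_one, mul_zero, zero_mul,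
      Finset.sum_ite_eq, Finset.mem_univ, if_true]
    exact (mul_assoc _ _ _).symm
  rw [h]
  simp only [map_sum, map_smul]
  refine Finset.sum_congr rfl fun s _ => Finset.sum_congr rfl fun t _ => ?_
  -- The maximally entangled pair is the Choi matrix of the identity channel.
  rw [← choi_id, discardPorts_biPow_choi (fun _ => rfl), smul_smul, portWeight]
  congr 1
  ring

/-- Measurement of an effect on the system `S` of `R × S` and the system `Z` of `G × Z`. -/
def measure {S Z : Type} [Fintype S] [Fintype Z] (E : Op (S × Z)) (R G : Type) :
    SuperOp ((R × S) × (G × Z)) (R × G) :=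
  relabel (fun p => (p, ())) ∘ₗ idTensor (R × G) (effect E) ∘ₗ
    relabel (Equiv.prodProdProdComm R G S Z)

/-- Selection of one of Bob's ports. -/
def selectPort {Y : Type} [Fintype Y] [DecidableEq Y] {M : ℕ} (i : Fin M) (C H : Type) :
    SuperOp (C × (H × (Fin M → Y))) ((C × Y) × H) :=
  relabel (⟨fun p => ((p.1.1, p.2), p.1.2), fun q => ((q.1.1, q.2), q.1.2), fun _ => rfl,
    fun _ => rfl⟩ : (C × Y) × H ≃ (C × H) × Y) ∘ₗ idTensor (C × H) (discardPorts i) ∘ₗ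
    relabel (Equiv.prodAssoc C H (Fin M → Y))

lemma isCP_measure {S Z : Type} [Fintype S] [Fintype Z] {E : Op (S × Z)} (hE : E.PosSemidef)
    (R G : Type) [Finite R] [Finite G] : IsCP (measure E R G) :=
  (isCP_relabel _).comp (((isCP_effect hE).idTensor _).comp (isCP_relabel _))

lemma sum_trace_measure {S Z ι : Type} [Fintype S] [Fintype Z] [DecidableEq S] [DecidableEq Z]
    [Fintype ι] {E : ι → Op (S × Z)} (hE : ∑ i, E i = 1) {R G : Type} [Fintype R] [Fintype G]
    (ρ : Op ((R × S) × (G × Z))) : ∑ i, (measure (E i) R G ρ).trace = ρ.trace := by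
  have h : ∀ i, (measure (E i) R G ρ).trace = (idTensor (R × G) (effect (E i))
      (relabel (Equiv.prodProdProdComm R G S Z) ρ)).trace := fun i =>
    (isChannel_relabel (Equiv.prodPUnit (R × G)).symm).tp _
  simp only [h, trace_idTensor]
  rw [Finset.sum_comm]
  simp only [sum_trace_effect hE, sum_trace_slice_snd]
  exact (isChannel_relabel _).tp ρ

lemma isChannel_selectPort {Y : Type} [Fintype Y] [DecidableEq Y] {M : ℕ} (i : Fin M)
    (C H : Type) [Fintype C] [Fintype H] :
    IsChannel (selectPort i C H : SuperOp (C × (H × (Fin M → Y))) ((C × Y) × H)) :=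
  (isChannel_relabel _).comp (((isChannel_discardPorts i).idTensor _).comp (isChannel_relabel _))

/-- Teleportation of the system `Fin d` of Alice's register `R × Fin d` over `M` copies of a
bipartite resource, of which Alice holds `Fin M → Fin d` and Bob `Fin M → Fin d'`. -/
def simulate (d d' M : ℕ) (R C G H : Type) :
    SuperOp (((R × Fin d) × (G × (Fin M → Fin d))) × (C × (H × (Fin M → Fin d'))))
      ((R × G) × ((C × Fin d') × H)) :=
  ∑ i, idTensor (R × G) (selectPort i C H) ∘ₗ
    tensorId (measure (povm d M i) R G) (C × (H × (Fin M → Fin d')))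

lemma isChannel_simulate {M : ℕ} (hM : 1 ≤ M) (R C G H : Type) [Fintype R] [Fintype C]
    [Fintype G] [Fintype H] : IsChannel (simulate d d' M R C G H) := by
  refine ⟨IsCP.sum _ fun i => ((isChannel_selectPort i C H).idTensor _).cp.comp
    ((isCP_measure (posSemidef_povm d M i) R G).tensorId _), fun ρ => ?_⟩
  simp only [simulate, LinearMap.sum_apply, LinearMap.comp_apply, Matrix.trace_sum,
    ((isChannel_selectPort _ C H).idTensor (R × G)).tp, trace_tensorId]
  rw [Finset.sum_comm]
  simp only [sum_trace_measure (sum_povm d hM), sum_trace_slice_fst]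

/-- The whole teleportation is one round by Alice with `M` outcomes; after outcome `i` Bob's part is
the local channel keeping port `i`. -/
lemma IsLOCC.comp_simulate {M : ℕ} (hM : 1 ≤ M) {R C G H A' B' : Type} [Fintype R] [Fintype C]
    [Fintype G] [Fintype H] [Fintype A'] [Fintype B']
    {Λ : SuperOp ((R × G) × ((C × Fin d') × H)) (A' × B')} (hΛ : IsLOCC Λ) :
    IsLOCC (Λ ∘ₗ simulate d d' M R C G H) := by
  have := IsLOCC.alice M (fun _ => R × G) (fun i => measure (povm d M i) R G)
    (fun i => isCP_measure (posSemidef_povm d M i) R G) (sum_trace_measure (sum_povm d hM))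
    (fun i => Λ ∘ₗ idTensor (R × G) (selectPort i C H))
    (fun i => hΛ.comp_idTensor (isChannel_selectPort i C H))
  convert this using 1
  refine LinearMap.ext fun ρ => ?_
  simp only [simulate, LinearMap.comp_apply, LinearMap.sum_apply, map_sum]

/-- No approximation occurs here: the entire error of the simulation sits in `Γ_M`. The operator `ω`
stands for the copies reserved for later uses, which pass through untouched. Entrywise, both sides
are the same sum over outcomes and matrix entries of the measured systems. -/
lemma simulate_interleave {M : ℕ} {E : SuperOp (Fin d) (Fin d')}
    (hE : ∀ ρ, (E ρ).trace = ρ.trace) {R C G H : Type} (τ : Op ((R × Fin d) × C))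
    (ω : Op (G × H)) :
    simulate d d' M R C G H (interleave τ (interleave ω (biPow M (choi E)))) =
      interleave (transmit (E ∘ₗ pbtChannel d M) R C τ) ω := by
  ext ⟨⟨r, g⟩, ⟨c, y⟩, h⟩ ⟨⟨r', g'⟩, ⟨c', y'⟩, h'⟩
  have key : ∀ i : Fin M, discardPorts i (Matrix.of fun f f' : Fin M → Fin d' =>
      ∑ s : Fin d × (Fin M → Fin d), ∑ t : Fin d × (Fin M → Fin d), povm d M i t s *
        interleave τ (interleave ω (biPow M (choi E))) (((r, s.1), (g, s.2)), (c, (h, f)))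
          (((r', t.1), (g', t.2)), (c', (h', f')))) =
      ω (g, h) (g', h') • E (∑ s, ∑ t, (portWeight d M i s t * τ ((r, s.1), c) ((r', t.1), c')) •
        entSlice d (s.2 i) (t.2 i)) := by
    intro i
    have hm : (Matrix.of fun f f' : Fin M → Fin d' =>
      ∑ s : Fin d × (Fin M → Fin d), ∑ t : Fin d × (Fin M → Fin d), povm d M i t s *
        interleave τ (interleave ω (biPow M (choi E))) (((r, s.1), (g, s.2)), (c, (h, f)))
          (((r', t.1), (g', t.2)), (c', (h', f')))) =
        ω (g, h) (g', h') • ∑ s, ∑ t, (povm d M i t s * τ ((r, s.1), c) ((r', t.1), c')) •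
          Matrix.of fun f f' => biPow M (choi E) (s.2, f) (t.2, f') := by
      ext f f'
      simp only [Matrix.of_apply, Matrix.smul_apply, Matrix.sum_apply, smul_eq_mul, Finset.mul_sum]
      refine Finset.sum_congr rfl fun s _ => Finset.sum_congr rfl fun t _ => ?_
      change _ * (τ ((r, s.1), c) ((r', t.1), c') *
        (ω (g, h) (g', h') * biPow M (choi E) (s.2, f) (t.2, f'))) = _
      ring
    rw [hm]
    simp only [map_sum, map_smul]
    congr 1
    refine Finset.sum_congr rfl fun s _ => Finset.sum_congr rfl fun t _ => ?_
    rw [discardPorts_biPow_choi hE, smul_smul, portWeight]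
    congr 1
    ring
  have hl : simulate d d' M R C G H (interleave τ (interleave ω (biPow M (choi E))))
      ((r, g), (c, y), h) ((r', g'), (c', y'), h') =
      ∑ i, discardPorts i (Matrix.of fun f f' : Fin M → Fin d' =>
      ∑ s : Fin d × (Fin M → Fin d), ∑ t : Fin d × (Fin M → Fin d), povm d M i t s *
        interleave τ (interleave ω (biPow M (choi E))) (((r, s.1), (g, s.2)), (c, (h, f)))
          (((r', t.1), (g', t.2)), (c', (h', f')))) y y' := by
    rw [simulate, LinearMap.sum_apply, Matrix.sum_apply]
    rfl
  rw [hl]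
  change _ = E (pbtChannel d M (Matrix.of fun x x' => τ ((r, x), c) ((r', x'), c'))) y y' *
    ω (g, h) (g', h')
  rw [pbtChannel_apply, map_sum, Matrix.sum_apply, Finset.sum_mul]
  refine Finset.sum_congr rfl fun i _ => ?_
  rw [key i]
  exact mul_comm _ _

end Simulation

/-! ### The teleportation channel and its simulation error -/

section Error

variable {d M : ℕ}

/-- The case `E = id` with trivial side systems. It presents the teleportation channel through
`simulate`, so that complete positivity and trace preservation are inherited rather than computed.
-/
lemma transmit_pbtChannel (d M : ℕ) {R C : Type} (τ : Op ((R × Fin d) × C)) :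
    transmit (pbtChannel d M) R C τ =
      relabel (fun p : R × (C × Fin d) => ((p.1, ()), (p.2, ())))
        (simulate d d M R C Unit Unit
          (interleave τ (interleave (1 : Op (Unit × Unit)) (biPow M (maxEnt d))))) := by
  have h := simulate_interleave (M := M) (E := (LinearMap.id : SuperOp (Fin d) (Fin d)))
    (fun _ => rfl) τ (1 : Op (Unit × Unit))
  rw [choi_id, LinearMap.id_comp] at h
  rw [h]
  ext p q
  exact (mul_one _).symm

lemma tensorId_eq_transmit {d' : ℕ} (E : SuperOp (Fin d) (Fin d')) {R : Type}
    (ρ : Op (Fin d × R)) :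
    tensorId E R ρ = relabel (fun p => ((), (p.2, p.1)))
      (transmit E Unit R (relabel (fun p => (p.1.2, p.2)) ρ)) :=
  rfl

lemma trace_transmit_unit {d' : ℕ} (E : SuperOp (Fin d) (Fin d')) (ρ : Op (Fin d)) :
    (transmit E Unit Unit (relabel (fun p => p.1.2) ρ)).trace = (E ρ).trace :=
  (isChannel_relabel (⟨fun p => p.2.2, fun x => ((), ((), x)), fun _ => rfl,
    fun _ => rfl⟩ : Unit × (Unit × Fin d') ≃ Fin d')).tp (E ρ)

lemma isChannel_pbtChannel (hd : 1 ≤ d) (hM : 1 ≤ M) : IsChannel (pbtChannel d M) := by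
  constructor
  · intro k ρ hρ
    rw [tensorId_eq_transmit, transmit_pbtChannel]
    exact (isCP_relabel _).posSemidef ((isCP_relabel _).posSemidef
      ((isChannel_simulate hM _ _ _ _).posSemidef
        (posSemidef_interleave ((isCP_relabel _).posSemidef hρ)
          (posSemidef_interleave Matrix.PosSemidef.one (posSemidef_biPow_maxEnt d M)))))
  · intro ρ
    have h : (relabel (fun p : (Unit × Fin d) × Unit => p.1.2) ρ).trace = ρ.trace :=
      (isChannel_relabel (⟨fun p => p.1.2, fun x => (((), x), ()), fun _ => rfl,
        fun _ => rfl⟩ : (Unit × Fin d) × Unit ≃ Fin d)).tp ρ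
    rw [← trace_transmit_unit, transmit_pbtChannel]
    refine ((isChannel_relabel (⟨fun p => ((p.1, ()), (p.2, ())), fun q => (q.1.1, q.2.1),
      fun _ => rfl, fun _ => rfl⟩ :
        Unit × (Unit × Fin d) ≃ (Unit × Unit) × ((Unit × Fin d) × Unit))).tp _).trans ?_
    rw [(isChannel_simulate hM _ _ _ _).tp, trace_interleave, trace_interleave, trace_biPow,
      trace_maxEnt hd, h]
    simp

lemma traceNorm_le_pbtError (hd : 1 ≤ d) (hM : 1 ≤ M) (k : ℕ) {ρ : Op (Fin d × Fin k)}
    (hρ : IsDensity ρ) :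
    traceNorm (ρ - tensorId (pbtChannel d M) (Fin k) ρ) ≤ pbtError d M := by
  -- A real supremum dominates its elements only if the set is bounded above; two states are at
  -- trace distance at most `1 + 1`.
  refine le_csSup ⟨2, ?_⟩ ⟨k, ρ, hρ, rfl⟩
  rintro _ ⟨k, ρ, hρ, rfl⟩
  have hΓ := ((isChannel_pbtChannel hd hM).tensorId (Fin k)).isDensity hρ
  refine (traceNorm_sub_le hρ.pos hΓ.pos).trans (le_of_eq ?_)
  rw [hρ.trace_one, hΓ.trace_one]
  norm_num

/-- The registers `R` and `C` are merged into one reference system `Fin k`, which turns `transmit`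
into `F ⊗ id`. The diamond distance bounds the error before `E` acts, and `E` followed by `Λ` cannot
increase it. -/
lemma traceNorm_transmit_le {d' : ℕ} (hd : 1 ≤ d) (hM : 1 ≤ M) {E : SuperOp (Fin d) (Fin d')}
    (hE : IsChannel E) {R C Z : Type} [Fintype R] [Fintype C] [Fintype Z] [DecidableEq Z]
    {Λ : SuperOp (R × (C × Fin d')) Z} (hΛ : IsChannel Λ) {τ : Op ((R × Fin d) × C)}
    (hτ : IsDensity τ) :
    traceNorm (Λ (transmit E R C τ) - Λ (transmit (E ∘ₗ pbtChannel d M) R C τ)) ≤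
      pbtError d M := by
  obtain ⟨k, ⟨e⟩⟩ := Finite.exists_equiv_fin (R × C)
  let u : Fin d × Fin k ≃ (R × Fin d) × C :=
    ⟨fun p => (((e.symm p.2).1, p.1), (e.symm p.2).2), fun q => (q.1.2, e (q.1.1, q.2)),
      fun p => by simp, fun q => by simp⟩
  let v : R × (C × Fin d') ≃ Fin d' × Fin k :=
    ⟨fun p => (p.2.2, e (p.1, p.2.1)), fun q => ((e.symm q.2).1, ((e.symm q.2).2, q.1)),
      fun p => by simp, fun q => by simp⟩
  have hu : ∀ F : SuperOp (Fin d) (Fin d'),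
      transmit F R C τ = relabel v (tensorId F (Fin k) (relabel u τ)) := by
    intro F
    ext p q
    change _ = F (Matrix.of fun x x' => τ (u (x, e (p.1, p.2.1))) (u (x', e (q.1, q.2.1)))) _ _
    simp only [u, Equiv.coe_fn_mk, Equiv.symm_apply_apply]
    rfl
  have hρ : IsDensity (relabel u τ) := (isChannel_relabel u).isDensity hτ
  have hΓ := ((isChannel_pbtChannel hd hM).tensorId (Fin k)).isDensity hρ
  refine le_trans ?_ (traceNorm_le_pbtError hd hM k hρ)
  have hchan : IsChannel (Λ ∘ₗ relabel v ∘ₗ tensorId E (Fin k)) :=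
    hΛ.comp ((isChannel_relabel v).comp (hE.tensorId _))
  refine le_of_eq_of_le ?_ (traceNorm_channel_le hchan (hρ.pos.1.sub hΓ.pos.1))
  rw [hu, hu, map_sub]
  rfl

end Error

/-! ### Stretching of adaptive protocols -/

section Stretching

variable {d d' : ℕ} {A' B' : Type} [Fintype A'] [Fintype B']

/-- The rest of the true protocol is a single channel, so an error made at an early use is not
amplified by later ones. -/
lemma isChannel_output {E : SuperOp (Fin d) (Fin d')} (hE : IsChannel E) {n : ℕ} {A B : Type}
    [Fintype A] [Fintype B] (P : AdaptiveProtocol d d' A' B' n A B) :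
    ∃ Λ : SuperOp (A × B) (A' × B'), IsChannel Λ ∧ ∀ ρ, P.output E ρ = Λ ρ := by
  induction P with
  | last Λ hΛ => exact ⟨Λ, hΛ, fun ρ => rfl⟩
  | step R C Λ hΛ rest ih =>
    obtain ⟨L, hL, h⟩ := ih
    exact ⟨L ∘ₗ transmit E R C ∘ₗ Λ, hL.comp ((isChannel_transmit hE R C).comp hΛ),
      fun ρ => h _⟩

/-- Regrouping of the `L` copies of a resource held by Alice and Bob into `N` and `K` copies. -/
def splitResource {N K L : ℕ} (e : Fin N ⊕ Fin K ≃ Fin L) (X Y A B : Type) :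
    SuperOp ((A × (Fin L → X)) × (B × (Fin L → Y)))
      ((A × ((Fin N → X) × (Fin K → X))) × (B × ((Fin N → Y) × (Fin K → Y)))) :=
  idTensor _ (relabel ((Equiv.refl B).prodCongr (joinPorts e Y))) ∘ₗ
    tensorId (relabel ((Equiv.refl A).prodCongr (joinPorts e X))) _

lemma splitResource_interleave {N K L : ℕ} (e : Fin N ⊕ Fin K ≃ Fin L) {X Y A B : Type}
    (ρ : Op (A × B)) (σ : Op (X × Y)) :
    splitResource e X Y A B (interleave ρ (biPow L σ)) =
      interleave ρ (interleave (biPow N σ) (biPow K σ)) := by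
  rw [← relabel_joinPorts_biPow e]
  rfl

/-- The stretched form of a protocol, acting on the initial registers and `n * M` copies of the
resource. -/
theorem exists_stretching {M : ℕ} (hd : 1 ≤ d) (hM : 1 ≤ M) [DecidableEq A'] [DecidableEq B']
    {n : ℕ} {A B : Type} [Fintype A] [Fintype B] (P : AdaptiveProtocol d d' A' B' n A B) :
    ∃ S : SuperOp ((A × (Fin (n * M) → Fin d)) × (B × (Fin (n * M) → Fin d'))) (A' × B'),
      IsChannel S ∧ (P.OpsLOCC → IsLOCC S) ∧
      ∀ E : SuperOp (Fin d) (Fin d'), IsChannel E → ∀ ρ : Op (A × B), IsDensity ρ →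
        IsDensity (P.output E ρ) ∧ (S (interleave ρ (biPow (n * M) (choi E)))).IsHermitian ∧
        traceNorm (P.output E ρ - S (interleave ρ (biPow (n * M) (choi E)))) ≤
          n * pbtError d M := by
  induction P with
  | @last A B _ _ Λ hΛ =>
    have : IsEmpty (Fin (0 * M)) := by
      rw [Nat.zero_mul]
      infer_instance
    have hS : ∀ (X Y : Type) (ρ : Op (A × B)) (σ : Op (X × Y)),
        idTensor A (relabel (Equiv.prodUnique B (Fin (0 * M) → Y)).symm)
          (tensorId (relabel (Equiv.prodUnique A (Fin (0 * M) → X)).symm) _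
            (interleave ρ (biPow (0 * M) σ))) = ρ := by
      intro X Y ρ σ
      ext p q
      change ρ p q * ∏ i : Fin (0 * M), (_ : ℂ) = ρ p q
      rw [Fintype.prod_empty, mul_one]
    refine ⟨(Λ ∘ₗ idTensor A (relabel (Equiv.prodUnique B (Fin (0 * M) → Fin d')).symm)) ∘ₗ
      tensorId (relabel (Equiv.prodUnique A (Fin (0 * M) → Fin d)).symm) _,
      (hΛ.comp ((isChannel_relabel _).idTensor _)).comp ((isChannel_relabel _).tensorId _),
      fun h => (IsLOCC.comp_idTensor (isChannel_relabel _) h).comp_tensorId (isChannel_relabel _),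
      fun E hE ρ hρ => ?_⟩
    simp only [LinearMap.comp_apply, hS]
    refine ⟨hΛ.isDensity hρ, (hΛ.isDensity hρ).pos.1, ?_⟩
    change traceNorm (Λ ρ - Λ ρ) ≤ _
    simp [traceNorm_zero]
  | @step n A B _ _ R C _ _ Λ hΛ rest ih =>
    obtain ⟨S, hS, hSL, hSE⟩ := ih
    -- The last `M` copies serve the first use, the other `n * M` are kept for the remaining
    -- protocol.
    let e : Fin (n * M) ⊕ Fin M ≃ Fin ((n + 1) * M) :=
      finSumFinEquiv.trans (finCongr (Nat.succ_mul n M).symm)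
    refine ⟨((S ∘ₗ simulate d d' M R C _ _) ∘ₗ extend Λ _ _) ∘ₗ splitResource e _ _ A B,
      ((hS.comp (isChannel_simulate hM _ _ _ _)).comp (isChannel_extend hΛ _ _)).comp
        (((isChannel_relabel _).idTensor _).comp ((isChannel_relabel _).tensorId _)),
      fun h => ?_, fun E hE ρ hρ => ?_⟩
    · have h' : IsLOCC Λ ∧ rest.OpsLOCC := h
      exact ((h'.1.comp_extend ((hSL h'.2).comp_simulate hM)).comp_idTensor
        (isChannel_relabel _)).comp_tensorId (isChannel_relabel _)
    · obtain ⟨L, hL, hout⟩ := isChannel_output hE rest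
      have hτ := hΛ.isDensity hρ
      have hout' : (AdaptiveProtocol.step R C Λ hΛ rest).output E ρ =
        L (transmit E R C (Λ ρ)) := hout _
      have hEΓ := hE.comp (isChannel_pbtChannel hd hM)
      have hτ' := (isChannel_transmit hEΓ R C).isDensity hτ
      -- The induction hypothesis starts from the state left by the simulated first use.
      obtain ⟨h1, h2, h3⟩ := hSE E hE _ hτ'
      have hρ1 := hL.isDensity ((isChannel_transmit hE R C).isDensity hτ)
      simp only [LinearMap.comp_apply, splitResource_interleave, extend_interleave,
        simulate_interleave hE.tp]
      rw [hout']
      refine ⟨hρ1, h2, ?_⟩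
      rw [hout] at h1 h3
      -- The intermediate hybrid simulates the first use and makes the others with the true `E`. The
      -- triangle inequality was proved for Hermitian operators, hence the Hermiticity clause in the
      -- induction.
      rw [← sub_add_sub_cancel _ (L (transmit (E ∘ₗ pbtChannel d M) R C (Λ ρ))) _]
      refine (traceNorm_add_le (hρ1.pos.1.sub h1.pos.1) (h1.pos.1.sub h2)).trans ?_
      have h4 := traceNorm_transmit_le hd hM hE hL hτ
      push_cast
      linarith

end Stretching

lemma interleave_kronecker {A B G H : Type} (α : Op A) (β : Op B) (σ : Op (G × H)) :
    idTensor (A × G) (attach β H) (tensorId (attach α G) H σ) = interleave (α ⊗ₖ β) σ := by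
  ext p q
  change β p.2.1 q.2.1 * (α p.1.1 q.1.1 * σ (p.1.2, p.2.2) (q.1.2, q.2.2)) =
    α p.1.1 q.1.1 * β p.2.1 q.2.1 * σ (p.1.2, p.2.2) (q.1.2, q.2.2)
  ring

/-- Each party attaches its own factor of the product state by a local channel. -/
lemma IsLOCC.comp_interleave {A B G H A' B' : Type} [Fintype A] [Fintype B] [Fintype G]
    [Fintype H] [Fintype A'] [Fintype B'] {Λ : SuperOp ((A × G) × (B × H)) (A' × B')}
    (hΛ : IsLOCC Λ) {ρ : Op (A × B)} (hρ : IsProductState ρ) :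
    IsLOCC (Λ ∘ₗ relabel (Equiv.prodProdProdComm A G B H) ∘ₗ attach ρ (G × H)) := by
  obtain ⟨α, β, hα, hβ, rfl⟩ := hρ
  have := (hΛ.comp_idTensor (isChannel_attach hβ H)).comp_tensorId (isChannel_attach hα G)
  convert this using 1
  refine LinearMap.ext fun σ => ?_
  exact congrArg Λ (interleave_kronecker α β σ).symm

end PBT

end

theorem lemma2 (d d' n M : ℕ) (hd : 1 ≤ d) (hM : 1 ≤ M)
    {A B A' B' : Type} [Fintype A] [Fintype B] [Fintype A'] [Fintype B']
    [DecidableEq A'] [DecidableEq B']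
    (P : PBT.AdaptiveProtocol d d' A' B' n A B)
    (ρ₀ : PBT.Op (A × B)) (hρ₀ : PBT.IsDensity ρ₀) :
    ∃ Λbar : PBT.SuperOp ((Fin (n * M) → Fin d) × (Fin (n * M) → Fin d')) (A' × B'),
      PBT.IsChannel Λbar ∧
      (∀ E : PBT.SuperOp (Fin d) (Fin d'), PBT.IsChannel E →
        PBT.traceNorm (P.output E ρ₀ - Λbar (PBT.biPow (n * M) (PBT.choi E)))
          ≤ n * PBT.pbtError d M) ∧
      (P.OpsLOCC → PBT.IsProductState ρ₀ → PBT.IsLOCC Λbar) := by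
  obtain ⟨S, hS, hSL, hSE⟩ := PBT.exists_stretching hd hM P
  -- The initial state is built into the map, leaving only the Choi copies as input.
  exact ⟨S ∘ₗ PBT.relabel (Equiv.prodProdProdComm _ _ _ _) ∘ₗ PBT.attach ρ₀ _,
    hS.comp ((PBT.isChannel_relabel _).comp (PBT.isChannel_attach hρ₀ _)),
    fun E hE => (hSE E hE ρ₀ hρ₀).2.2, fun h hprod => (hSL h).comp_interleave hprod⟩
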